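/- For $A\in M_n(\mathbb C)$, $\theta\in[0,2\pi)$ let $H_\theta(A)=\tfrac12(e^{i\theta}A+e^{-i\theta}A^*)$, and for a Hermitian matrix $H\in M_n(\mathbb C)$ let $\lambda_1(H)\ge\dots\ge\lambda_n(H)$ be its eigenvalues. For $c=(c_1,\dots,c_n)\in\mathbb R^n$ the weighted numerical range of $A$ is $$W(A;c)=\bigcap_{\theta\in[0,2\pi)}\Big\{v\in\mathbb C:\ \operatorname{Re}(e^{i\theta}v)\le \sum_{j=1}^n c_j\lambda_j(H_\theta(A))\Big\}.$$ Let $\lambda_1(A),\dots,\lambda_n(A)$ be the eigenvalues of $A\in M_n(\mathbb C)$, with algebraic multiplicity, and let $c_{i_1},\dots,c_{i_r}$ be the nonzero entries of $c$. A $c$-value of $A$ is a number $c_{i_1}\lambda_{j_1}(A)+\dots+c_{i_r}\lambda_{j_r}(A)$ with $j_1,\dots,j_r$ distinct. The $c$-polynomial $p(A;c)(t)$ is the monic polynomial whose roots are the generically distinct $c$-values, that is, $p(A;c)(t)=\prod_{c'}\big(t-\sum_j c'_j\lambda_j(A)\big)$, where $c'$ runs over the distinct rearrangements of $c$. Let $r(A;c)(x,y,t)=p(xA+yA^*;c)(t)$,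 which is a polynomial in $\mathbb C[x,y,t]$. **Corollary.** Let $A\in M_n(\mathbb C)$, $B\in M_m(\mathbb C)$, $c\in\mathbb R^n$ and $d\in\mathbb R^m$. Suppose that there is a differentiable curve, with nonvanishing derivative and not contained in a straight line, that lies on $\partial W(A;c)\cap\partial W(B;d)$. Then there exists a $c$-value of $A$ which is also a $d$-value of $B$. Furthermore, if $r(A;c)$ is irreducible in $\mathbb C[x,y,t]$, then all the $c$-values of $A$ are $d$-values of $B$. -/

import Mathlib

namespace WeightedRange

open Matrix

/-! ### The weighted numerical range -/

/-- `H_θ(A) = (e^{iθ} A + e^{-iθ} A*) / 2`. -/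
noncomputable def hermPart {n : ℕ} (A : Matrix (Fin n) (Fin n) ℂ) (θ : ℝ) :
    Matrix (Fin n) (Fin n) ℂ :=
  (1 / 2 : ℂ) • (Complex.exp (θ * Complex.I) • A + Complex.exp (-(θ * Complex.I)) • Aᴴ)

theorem hermPart_isHermitian {n : ℕ} (A : Matrix (Fin n) (Fin n) ℂ) (θ : ℝ) :
    (hermPart A θ).IsHermitian := by
  have h1 : star (Complex.exp (θ * Complex.I)) = Complex.exp (-(θ * Complex.I)) := by
    simp [← Complex.exp_conj]
  have h2 : star (Complex.exp (-(θ * Complex.I))) = Complex.exp (θ * Complex.I) := by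
    simp [← Complex.exp_conj]
  have h3 : star (1 / 2 : ℂ) = 1 / 2 := by simp
  unfold Matrix.IsHermitian hermPart
  rw [conjTranspose_smul, conjTranspose_add, conjTranspose_smul, conjTranspose_smul,
    conjTranspose_conjTranspose, h1, h2, h3, add_comm]

/-- The eigenvalues `λ₁ ≥ λ₂ ≥ ⋯ ≥ λₙ` of a Hermitian matrix, in decreasing order
(`Matrix.IsHermitian.eigenvalues₀` is antitone). -/
noncomputable def sortedEig {n : ℕ} {H : Matrix (Fin n) (Fin n) ℂ} (hH : H.IsHermitian)
    (j : Fin n) : ℝ :=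
  hH.eigenvalues₀ (Fin.cast (Fintype.card_fin n).symm j)

/-- `∑ⱼ cⱼ λⱼ(H_θ(A))`. -/
noncomputable def supportValue {n : ℕ} (A : Matrix (Fin n) (Fin n) ℂ) (c : Fin n → ℝ)
    (θ : ℝ) : ℝ :=
  ∑ j, c j * sortedEig (hermPart_isHermitian A θ) j

/-- The weighted numerical range `W(A; c)`. -/
def weightedRange {n : ℕ} (A : Matrix (Fin n) (Fin n) ℂ) (c : Fin n → ℝ) : Set ℂ :=
  ⋂ θ ∈ Set.Ico (0 : ℝ) (2 * Real.pi),
    {v : ℂ | (Complex.exp (θ * Complex.I) * v).re ≤ supportValue A c θ}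

/-! ### `c`-values and the `c`-polynomial -/

theorem exists_eigs {n : ℕ} (A : Matrix (Fin n) (Fin n) ℂ) :
    ∃ f : Fin n → ℂ, Finset.univ.val.map f = A.charpoly.roots := by
  have hc : A.charpoly.roots.toList.length = n := by
    rw [Multiset.length_toList, ← (IsAlgClosed.splits A.charpoly).natDegree_eq_card_roots,
      Matrix.charpoly_natDegree_eq_dim, Fintype.card_fin]
  refine ⟨fun j => A.charpoly.roots.toList.get (Fin.cast hc.symm j), ?_⟩
  conv_rhs => rw [← Multiset.coe_toList A.charpoly.roots]
  rw [Fin.univ_val_map]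
  congr 1
  apply List.ext_get
  · simp [hc]
  · intro k h1 h2
    simp

/-- An enumeration of the `n` eigenvalues of `A`, with algebraic multiplicity. -/
noncomputable def eigs {n : ℕ} (A : Matrix (Fin n) (Fin n) ℂ) : Fin n → ℂ :=
  (exists_eigs A).choose

theorem eigs_spec {n : ℕ} (A : Matrix (Fin n) (Fin n) ℂ) :
    Finset.univ.val.map (eigs A) = A.charpoly.roots :=
  (exists_eigs A).choose_spec

/-- `z` is a `c`-value of `A`: the nonzero entries of `c` are paired with eigenvalues of `A`
with distinct indices, and `z` is the sum of the products. -/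
def IsCValue {n : ℕ} (A : Matrix (Fin n) (Fin n) ℂ) (c : Fin n → ℝ) (z : ℂ) : Prop :=
  ∃ j : {i : Fin n // c i ≠ 0} ↪ Fin n, z = ∑ i : {i : Fin n // c i ≠ 0}, (c i : ℂ) * eigs A (j i)

/-- The distinct rearrangements of the tuple `c`. -/
noncomputable def rearrangements {n : ℕ} (c : Fin n → ℝ) : Finset (Fin n → ℝ) :=
  Finset.univ.image (fun σ : Equiv.Perm (Fin n) => c ∘ σ)

/-- The `c`-polynomial `p(A; c)(t)`. The `c`-values that are distinct for generic eigenvalues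
`λ₁, …, λₙ` are the linear forms `∑ⱼ c'ⱼ λⱼ`, one for each distinct rearrangement `c'` of `c`. -/
noncomputable def cPoly {n : ℕ} (A : Matrix (Fin n) (Fin n) ℂ) (c : Fin n → ℝ) :
    Polynomial ℂ :=
  ∏ c' ∈ rearrangements c,
    (Polynomial.X - Polynomial.C (∑ j, (c' j : ℂ) * eigs A j))

theorem exists_rPoly {n : ℕ} (A : Matrix (Fin n) (Fin n) ℂ) (c : Fin n → ℝ) :
    ∃! r : MvPolynomial (Fin 3) ℂ, ∀ x y t : ℂ,
      MvPolynomial.eval ![x, y, t] r = (cPoly (x • A + y • Aᴴ) c).eval t := by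
  classical
  apply existsUnique_of_exists_of_unique
  swap
  · intro r s hr hs
    apply MvPolynomial.funext
    intro v
    have hv : v = ![v 0, v 1, v 2] := by
      ext i; fin_cases i <;> rfl
    rw [hv, hr, hs]
  -- the product over the rearrangements, as a symmetric polynomial in formal eigenvalues
  let S : MvPolynomial (Fin n) (MvPolynomial (Fin 3) ℂ) :=
    ∏ c' ∈ rearrangements c, (MvPolynomial.C (MvPolynomial.X 2) -
      ∑ j, MvPolynomial.C (MvPolynomial.C (c' j : ℂ)) * MvPolynomial.X j)
  have hS : S.IsSymmetric := by
    intro e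
    simp only [S, map_prod, map_sub, map_sum, map_mul, MvPolynomial.rename_C,
      MvPolynomial.rename_X]
    refine Finset.prod_bij' (fun c' _ => c' ∘ e.symm) (fun c' _ => c' ∘ e) ?_ ?_ ?_ ?_ ?_
    · intro a ha
      simp only [rearrangements, Finset.mem_image, Finset.mem_univ, true_and] at ha ⊢
      obtain ⟨σ, rfl⟩ := ha
      exact ⟨e.symm.trans σ, rfl⟩
    · intro a ha
      simp only [rearrangements, Finset.mem_image, Finset.mem_univ, true_and] at ha ⊢
      obtain ⟨σ, rfl⟩ := ha
      exact ⟨e.trans σ, rfl⟩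
    · intro a _; ext i; simp
    · intro a _; ext i; simp
    · intro a _
      congr 1
      refine Fintype.sum_equiv e _ _ ?_
      intro j; simp
  obtain ⟨Q, hQ⟩ := MvPolynomial.esymmAlgHom_surjective (σ := Fin n) (n := n)
    (MvPolynomial (Fin 3) ℂ) (by simp) ⟨S, hS⟩
  have hQ' : MvPolynomial.aeval
      (fun i : Fin n => MvPolynomial.esymm (Fin n) (MvPolynomial (Fin 3) ℂ) (i + 1)) Q = S := by
    rw [← MvPolynomial.esymmAlgHom_apply, hQ]
  let M : Matrix (Fin n) (Fin n) (MvPolynomial (Fin 3) ℂ) :=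
    (MvPolynomial.X 0 : MvPolynomial (Fin 3) ℂ) • A.map MvPolynomial.C +
      (MvPolynomial.X 1 : MvPolynomial (Fin 3) ℂ) • Aᴴ.map MvPolynomial.C
  refine ⟨MvPolynomial.aeval
    (fun i : Fin n => (-1) ^ ((i : ℕ) + 1) * M.charpoly.coeff (n - (i + 1))) Q, ?_⟩
  intro x y t
  set ev : MvPolynomial (Fin 3) ℂ →+* ℂ := MvPolynomial.eval ![x, y, t] with hev
  have hM : M.map ev = x • A + y • Aᴴ := by
    ext i j
    simp [M, hev]
  set N := x • A + y • Aᴴ with hN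
  have hdeg : N.charpoly.natDegree = n := by
    rw [Matrix.charpoly_natDegree_eq_dim, Fintype.card_fin]
  have hcoef : ∀ i : Fin n,
      ev ((-1) ^ ((i : ℕ) + 1) * M.charpoly.coeff (n - (i + 1))) =
        (Finset.univ.val.map (eigs N)).esymm (i + 1) := by
    intro i
    have h1 : ev (M.charpoly.coeff (n - (i + 1))) = N.charpoly.coeff (n - (i + 1)) := by
      rw [← hM, Matrix.charpoly_map, Polynomial.coeff_map]
    rw [map_mul, h1, Polynomial.coeff_eq_esymm_roots_of_card
      (IsAlgClosed.splits N.charpoly).natDegree_eq_card_roots.symm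
      (by rw [hdeg]; omega), hdeg, (Matrix.charpoly_monic N).leadingCoeff, eigs_spec]
    have h2 : n - (n - ((i : ℕ) + 1)) = i + 1 := by omega
    rw [h2, map_pow, map_neg, map_one, one_mul, ← mul_assoc, ← mul_pow]
    simp
  have hL : ev (MvPolynomial.aeval
      (fun i : Fin n => (-1) ^ ((i : ℕ) + 1) * M.charpoly.coeff (n - (i + 1))) Q) =
      MvPolynomial.eval₂ ev (eigs N) S := by
    rw [← hQ', MvPolynomial.aeval_def, MvPolynomial.aeval_def, ← MvPolynomial.coe_eval₂Hom,
      ← MvPolynomial.coe_eval₂Hom, MvPolynomial.coe_eval₂Hom, MvPolynomial.coe_eval₂Hom,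
      MvPolynomial.hom_eval₂, ← MvPolynomial.coe_eval₂Hom ev, MvPolynomial.hom_eval₂]
    congr 1
    · ext <;> simp
    · funext i
      rw [hcoef, ← MvPolynomial.aeval_esymm_eq_multiset_esymm (Fin n) ℂ]
      simp only [MvPolynomial.esymm, map_sum, map_prod, MvPolynomial.aeval_X,
        MvPolynomial.coe_eval₂Hom, MvPolynomial.eval₂_X]
  rw [hL]
  simp only [S, cPoly, Polynomial.eval_prod, Polynomial.eval_sub, Polynomial.eval_X, ← MvPolynomial.coe_eval₂Hom, map_prod, map_sub, map_sum, map_mul]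
  simp [hev, Polynomial.eval_finsetSum]

/-- `r(A; c)(x, y, t) = p(xA + yA*; c)(t)`, as a polynomial in the three variables
`x = X 0`, `y = X 1`, `t = X 2`. -/
noncomputable def rPoly {n : ℕ} (A : Matrix (Fin n) (Fin n) ℂ) (c : Fin n → ℝ) :
    MvPolynomial (Fin 3) ℂ :=
  (exists_rPoly A c).choose

theorem eval_rPoly {n : ℕ} (A : Matrix (Fin n) (Fin n) ℂ) (c : Fin n → ℝ) (x y t : ℂ) :
    MvPolynomial.eval ![x, y, t] (rPoly A c) = (cPoly (x • A + y • Aᴴ) c).eval t :=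
  (exists_rPoly A c).choose_spec.1 x y t

/-! ### Curves -/

/-- `γ` is a differentiable (parametrised) curve on the interval `I`: at each point it has a
nonzero velocity vector (one-sided at an end point of `I`), hence a tangent line. -/
structure IsDifferentiableCurve (γ : ℝ → ℂ) (I : Set ℝ) : Prop where
  interval : I.OrdConnected
  regular : ∀ t ∈ I, ∃ v : ℂ, v ≠ 0 ∧ HasDerivWithinAt γ v I t

end WeightedRange

/-! ### Roots of the `c`-polynomial and sorted eigenvalues. -/

namespace WeightedRange

open Matrix

/-! Every boundary point of `W(A; c)` lies on a line `Re(e^{iθ}v) = ∑ cⱼλⱼ(H_θ(A))`, and likewise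
for `B`. At an interior parameter of the curve both lines must be tangent to it, so their directions
agree up to sign; opposite directions would force the curve into a line. Hence both have the same
`θ` and the support values coincide there. If only finitely many `θ` occurred, connectedness would
put the curve on a single line, so they coincide for infinitely many `θ`
(`infinite_supportValue_eq`).

For each such `θ` the support value is a common root of `p(H_θ(A); c)` and `p(H_θ(B); d)`. Since `s
e^{2iθ}A + sA* = 2s e^{iθ}H_θ(A)`, the resultant in `t` of `r(A; c)` and `r(B; d)`, a polynomial in
`x, y`, vanishes on infinitely many lines through the origin, hence identically
(`resultant_tPolyEquiv_rPoly_eq_zero`). At `(x, y) = (1, 0)` this yields a common root of `p(A; c)`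
and `p(B; d)`. If `r(A; c)` is irreducible, Gauss's lemma turns the vanishing resultant into `r(A;
c) ∣ r(B; d)`, which specialises at the same point. -/

theorem exists_perm_of_map_univ_eq {ι α : Type*} [Fintype ι] {f g : ι → α}
    (h : Finset.univ.val.map f = Finset.univ.val.map g) :
    ∃ σ : Equiv.Perm ι, ∀ i, f i = g (σ i) := by
  classical
  have key : ∀ z : α, Nonempty ({i // f i = z} ≃ {i // g i = z}) := by
    intro z
    have hz := congrArg (Multiset.count z) h
    rw [Multiset.count_map, Multiset.count_map] at hz
    refine Fintype.card_eq.mp ?_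
    rw [Fintype.card_subtype, Fintype.card_subtype]
    simpa [Finset.card, Finset.filter_val, eq_comm] using hz
  let e := fun z => (key z).some
  refine ⟨((Equiv.sigmaFiberEquiv f).symm.trans (Equiv.sigmaCongrRight e)).trans
    (Equiv.sigmaFiberEquiv g), fun i => ?_⟩
  exact ((e (f i)) ⟨i, rfl⟩).2.symm

theorem map_univ_eq_charpoly_roots {n : ℕ} {M : Matrix (Fin n) (Fin n) ℂ} {f : Fin n → ℂ}
    (h : ∀ t : ℂ, M.charpoly.eval t = ∏ j, (t - f j)) :
    Finset.univ.val.map f = M.charpoly.roots := by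
  have h1 : M.charpoly = ∏ j, (Polynomial.X - Polynomial.C (f j)) := by
    apply Polynomial.funext
    intro t
    rw [h, Polynomial.eval_prod]
    simp
  rw [h1, Polynomial.roots_prod _ _
    (Finset.prod_ne_zero_iff.mpr fun j _ => Polynomial.X_sub_C_ne_zero (f j))]
  simp

theorem eval_charpoly_eq_prod {n : ℕ} {M : Matrix (Fin n) (Fin n) ℂ} {f : Fin n → ℂ}
    (h : Finset.univ.val.map f = M.charpoly.roots) (t : ℂ) :
    M.charpoly.eval t = ∏ j, (t - f j) := by
  conv_lhs => rw [(IsAlgClosed.splits M.charpoly).eq_prod_roots_of_monic (charpoly_monic M), ← h]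
  rw [Multiset.map_map, ← Finset.prod_eq_multiset_prod, Polynomial.eval_prod]
  simp

/-- Frees the roots from the arbitrary choice made in `eigs`, so that sorted or rescaled eigenvalues
can be used instead. -/
theorem cPoly_isRoot_iff {n : ℕ} {M : Matrix (Fin n) (Fin n) ℂ} {f : Fin n → ℂ}
    (h : Finset.univ.val.map f = M.charpoly.roots) (c : Fin n → ℝ) (t : ℂ) :
    (cPoly M c).IsRoot t ↔ ∃ σ : Equiv.Perm (Fin n), t = ∑ j, (c j : ℂ) * f (σ j) := by
  obtain ⟨τ, hτ⟩ := exists_perm_of_map_univ_eq ((eigs_spec M).trans h.symm)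
  rw [Polynomial.IsRoot.def, cPoly, Polynomial.eval_prod, Finset.prod_eq_zero_iff]
  simp only [Polynomial.eval_sub, Polynomial.eval_X, Polynomial.eval_C, sub_eq_zero,
    rearrangements, Finset.mem_image, Finset.mem_univ, true_and, exists_exists_eq_and,
    Function.comp_apply]
  constructor
  · rintro ⟨σ, rfl⟩
    refine ⟨σ.symm.trans τ, Fintype.sum_equiv σ _ _ fun j => ?_⟩
    simp [hτ]
  · rintro ⟨σ, rfl⟩
    refine ⟨(σ.trans τ.symm).symm, Fintype.sum_equiv (σ.trans τ.symm) _ _ fun j => ?_⟩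
    rw [hτ]
    simp

theorem cPoly_isRoot_iff_isCValue {n : ℕ} (M : Matrix (Fin n) (Fin n) ℂ) (c : Fin n → ℝ) (t : ℂ) :
    (cPoly M c).IsRoot t ↔ IsCValue M c t := by
  classical
  have hsum : ∀ g : Fin n → ℂ,
      ∑ j, (c j : ℂ) * g j = ∑ i : {i : Fin n // c i ≠ 0}, (c i : ℂ) * g i := by
    intro g
    rw [← Finset.sum_subtype (Finset.univ.filter (c · ≠ 0)) (by simp) fun i => (c i : ℂ) * g i]
    refine (Finset.sum_filter_of_ne (p := fun i => c i ≠ 0) fun i _ hi h0 => hi ?_).symm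
    simp [h0]
  rw [cPoly_isRoot_iff (eigs_spec M)]
  constructor
  · rintro ⟨σ, rfl⟩
    exact ⟨(Function.Embedding.subtype _).trans σ.toEmbedding, hsum fun j => eigs M (σ j)⟩
  · rintro ⟨j, rfl⟩
    -- A partial injection of a finite set extends to a permutation; the added indices carry zero
    -- weight.
    let e : {i : Fin n // c i ≠ 0} ≃ {i : Fin n // i ∈ Set.range j} := j.toEquivRange
    refine ⟨e.extendSubtype, ?_⟩
    rw [hsum]
    refine Finset.sum_congr rfl fun i _ => ?_
    rw [e.extendSubtype_apply_of_mem i.1 i.2]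
    rfl

theorem cPoly_monic {n : ℕ} (M : Matrix (Fin n) (Fin n) ℂ) (c : Fin n → ℝ) :
    (cPoly M c).Monic :=
  Polynomial.monic_prod_of_monic _ _ fun _ _ => Polynomial.monic_X_sub_C _

theorem cPoly_natDegree {n : ℕ} (M : Matrix (Fin n) (Fin n) ℂ) (c : Fin n → ℝ) :
    (cPoly M c).natDegree = (rearrangements c).card := by
  rw [cPoly, Polynomial.natDegree_prod_of_monic _ _ fun _ _ => Polynomial.monic_X_sub_C _]
  simp only [Polynomial.natDegree_X_sub_C, Finset.sum_const, smul_eq_mul, mul_one]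

theorem cPoly_isRoot_smul {n : ℕ} {M : Matrix (Fin n) (Fin n) ℂ} {c : Fin n → ℝ} {t s : ℂ}
    (hs : s ≠ 0) (h : (cPoly M c).IsRoot t) : (cPoly (s • M) c).IsRoot (s * t) := by
  have hroots : Finset.univ.val.map (fun j => s * eigs M j) = (s • M).charpoly.roots := by
    apply map_univ_eq_charpoly_roots
    intro t
    have h1 := eval_charpoly_eq_prod (eigs_spec M) (s⁻¹ * t)
    rw [eval_charpoly] at h1 ⊢
    have h2 : scalar (Fin n) t - s • M = s • (scalar (Fin n) (s⁻¹ * t) - M) := by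
      rw [smul_sub]
      congr 1
      ext i j
      by_cases hij : i = j <;> simp [hij, hs]
    rw [h2, det_smul, h1, ← Finset.card_univ, ← Finset.prod_const, ← Finset.prod_mul_distrib]
    refine Finset.prod_congr rfl fun j _ => ?_
    field_simp
  obtain ⟨σ, rfl⟩ := (cPoly_isRoot_iff (eigs_spec M) c t).1 h
  refine (cPoly_isRoot_iff hroots c _).2 ⟨σ, ?_⟩
  rw [Finset.mul_sum]
  exact Finset.sum_congr rfl fun j _ => by ring

theorem map_sortedEig {n : ℕ} {H : Matrix (Fin n) (Fin n) ℂ} (hH : H.IsHermitian) :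
    Finset.univ.val.map (fun j => (sortedEig hH j : ℂ)) = H.charpoly.roots := by
  rw [hH.roots_charpoly_eq_eigenvalues₀, ← Multiset.map_univ_val_equiv
    (finCongr (Fintype.card_fin n).symm), Multiset.map_map]
  rfl

theorem sortedEig_antitone {n : ℕ} {H : Matrix (Fin n) (Fin n) ℂ} (hH : H.IsHermitian) :
    Antitone (sortedEig hH) :=
  fun _ _ h => hH.eigenvalues₀_antitone h

theorem cPoly_isRoot_supportValue {n : ℕ} (A : Matrix (Fin n) (Fin n) ℂ) (c : Fin n → ℝ)
    (θ : ℝ) : (cPoly (hermPart A θ) c).IsRoot (supportValue A c θ) := by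
  refine (cPoly_isRoot_iff (map_sortedEig (hermPart_isHermitian A θ)) c _).2 ⟨1, ?_⟩
  simp [supportValue]

theorem eq_sortedEig {n : ℕ} {H : Matrix (Fin n) (Fin n) ℂ} (hH : H.IsHermitian)
    {μ : Fin n → ℝ} (hμ : Antitone μ) (h : ∀ t : ℂ, H.charpoly.eval t = ∏ j, (t - μ j)) :
    μ = sortedEig hH := by
  have h1 := (map_univ_eq_charpoly_roots h).trans (map_sortedEig hH).symm
  have h2 : Finset.univ.val.map μ = Finset.univ.val.map (sortedEig hH) := by
    have := congrArg (Multiset.map Complex.re) h1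
    simpa [Multiset.map_map, Function.comp_def] using this
  rw [Fin.univ_val_map, Fin.univ_val_map, Multiset.coe_eq_coe] at h2
  exact List.ofFn_injective (h2.eq_of_sortedGE hμ.sortedGE_ofFn
    (sortedEig_antitone hH).sortedGE_ofFn)

end WeightedRange

/-! ### Boundary points and supporting lines. -/

namespace WeightedRange

open Matrix Filter Topology

theorem continuous_hermPart {n : ℕ} (A : Matrix (Fin n) (Fin n) ℂ) :
    Continuous (hermPart A) := by
  unfold hermPart
  fun_prop

theorem hermPart_two_pi {n : ℕ} (A : Matrix (Fin n) (Fin n) ℂ) :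
    hermPart A (2 * Real.pi) = hermPart A 0 := by
  simp [hermPart, Complex.exp_neg]

theorem supportValue_congr {n : ℕ} {A : Matrix (Fin n) (Fin n) ℂ} (c : Fin n → ℝ) {θ φ : ℝ}
    (h : hermPart A θ = hermPart A φ) : supportValue A c θ = supportValue A c φ := by
  unfold supportValue
  simp only [h]

theorem isClosed_weightedRange {n : ℕ} (A : Matrix (Fin n) (Fin n) ℂ) (c : Fin n → ℝ) :
    IsClosed (weightedRange A c) := by
  refine isClosed_biInter fun θ _ => isClosed_le ?_ continuous_const
  fun_prop

theorem exists_abs_sortedEig_hermPart_le {n : ℕ} (A : Matrix (Fin n) (Fin n) ℂ) :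
    ∃ C : ℝ, ∀ θ ∈ Set.Icc 0 (2 * Real.pi), ∀ j,
      |sortedEig (hermPart_isHermitian A θ) j| ≤ C := by
  let _ : NormedRing (Matrix (Fin n) (Fin n) ℂ) := Matrix.linftyOpNormedRing
  let _ : NormedAlgebra ℂ (Matrix (Fin n) (Fin n) ℂ) := Matrix.linftyOpNormedAlgebra
  have hcont : Continuous fun θ => ‖hermPart A θ‖ * ‖(1 : Matrix (Fin n) (Fin n) ℂ)‖ :=
    (continuous_norm.comp (continuous_hermPart A)).mul continuous_const
  obtain ⟨C, hC⟩ := (isCompact_Icc (a := (0 : ℝ)) (b := 2 * Real.pi)).bddAbove_image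
    hcont.continuousOn
  refine ⟨C, fun θ hθ j => le_trans ?_ (hC ⟨θ, hθ, rfl⟩)⟩
  rw [← Real.norm_eq_abs, ← Complex.norm_real]
  apply spectrum.norm_le_norm_mul_of_mem
  rw [mem_spectrum_iff_isRoot_charpoly, ← Polynomial.mem_roots (charpoly_monic _).ne_zero,
    ← map_sortedEig (hermPart_isHermitian A θ)]
  exact Multiset.mem_map_of_mem _ (Finset.mem_univ j)

/-- A compactness substitute for continuity of eigenvalues: a limit of sorted spectra is still
sorted and has the limiting characteristic polynomial, so it is the sorted spectrum at the limit
angle. -/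
theorem exists_subseq_tendsto_supportValue {n : ℕ} (A : Matrix (Fin n) (Fin n) ℂ) (c : Fin n → ℝ)
    {u : ℕ → ℝ} (hu : ∀ k, u k ∈ Set.Icc 0 (2 * Real.pi)) :
    ∃ θ ∈ Set.Icc 0 (2 * Real.pi), ∃ φ : ℕ → ℕ, StrictMono φ ∧ Tendsto (u ∘ φ) atTop (𝓝 θ) ∧
      Tendsto (fun k => supportValue A c (u (φ k))) atTop (𝓝 (supportValue A c θ)) := by
  obtain ⟨C, hC⟩ := exists_abs_sortedEig_hermPart_le A
  let K : Set (ℝ × (Fin n → ℝ)) :=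
    Set.Icc 0 (2 * Real.pi) ×ˢ Set.univ.pi fun _ => Set.Icc (-C) C
  have hK : IsCompact K := isCompact_Icc.prod (isCompact_univ_pi fun _ => isCompact_Icc)
  obtain ⟨⟨θ, μ⟩, hmem, φ, hφ, hlim⟩ := hK.tendsto_subseq
    (x := fun k => (u k, sortedEig (hermPart_isHermitian A (u k))))
    fun k => ⟨hu k, fun j _ => abs_le.1 (hC _ (hu k) j)⟩
  have hθ : Tendsto (u ∘ φ) atTop (𝓝 θ) := (continuous_fst.tendsto _).comp hlim
  have hμ : ∀ j, Tendsto (fun k => sortedEig (hermPart_isHermitian A (u (φ k))) j) atTop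
      (𝓝 (μ j)) := tendsto_pi_nhds.1 ((continuous_snd.tendsto _).comp hlim)
  have hμeq : μ = sortedEig (hermPart_isHermitian A θ) := by
    apply eq_sortedEig
    · exact fun i j hij => le_of_tendsto_of_tendsto' (hμ j) (hμ i)
        fun k => sortedEig_antitone _ hij
    · intro t
      have h1 : Continuous fun θ => (hermPart A θ).charpoly.eval t := by
        simp only [eval_charpoly]
        exact (continuous_const.sub (continuous_hermPart A)).matrix_det
      have h2 := (h1.tendsto θ).comp hθ
      have h3 : Tendsto (fun k => ∏ j, (t -
          (sortedEig (hermPart_isHermitian A (u (φ k))) j : ℂ))) atTop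
          (𝓝 (∏ j, (t - (μ j : ℂ)))) :=
        tendsto_finsetProd _ fun j _ => tendsto_const_nhds.sub
          ((Complex.continuous_ofReal.tendsto _).comp (hμ j))
      refine tendsto_nhds_unique h2 (h3.congr fun k => ?_)
      exact (eval_charpoly_eq_prod (map_sortedEig (hermPart_isHermitian A (u (φ k)))) t).symm
  refine ⟨θ, hmem.1, φ, hφ, hθ, ?_⟩
  unfold supportValue
  rw [← hμeq]
  exact tendsto_finsetSum _ fun j _ => (hμ j).const_mul _

/-- Every boundary point of the weighted numerical range lies on one of its defining lines. -/
theorem exists_eq_supportValue_of_mem_frontier {n : ℕ} {A : Matrix (Fin n) (Fin n) ℂ}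
    {c : Fin n → ℝ} {v : ℂ} (hv : v ∈ frontier (weightedRange A c)) :
    ∃ θ ∈ Set.Ico 0 (2 * Real.pi),
      (Complex.exp (θ * Complex.I) * v).re = supportValue A c θ := by
  have hvW : v ∈ weightedRange A c := (isClosed_weightedRange A c).frontier_subset hv
  have hv' : v ∈ closure (weightedRange A c)ᶜ := by
    rw [← frontier_compl] at hv
    exact frontier_subset_closure hv
  -- Each outside point near `v` violates some constraint; a limit of the violated angles gives a
  -- constraint that is tight at `v`.
  obtain ⟨w, hw, hwlim⟩ := mem_closure_iff_seq_limit.1 hv'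
  have hex : ∀ k, ∃ θ ∈ Set.Ico 0 (2 * Real.pi),
      supportValue A c θ < (Complex.exp (θ * Complex.I) * w k).re := by
    intro k
    have hk := hw k
    simp only [weightedRange, Set.mem_compl_iff, Set.mem_iInter, Set.mem_ofPred_eq, not_forall,
      not_le, exists_prop] at hk
    exact hk
  choose u hu hlt using hex
  obtain ⟨θ, hθ, φ, hφ, hlim, hsup⟩ :=
    exists_subseq_tendsto_supportValue A c fun k => Set.Ico_subset_Icc_self (hu k)
  have hge : supportValue A c θ ≤ (Complex.exp (θ * Complex.I) * v).re := by
    refine le_of_tendsto_of_tendsto' hsup ?_ fun k => (hlt (φ k)).le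
    refine (Complex.continuous_re.tendsto _).comp (Tendsto.mul ?_ (hwlim.comp hφ.tendsto_atTop))
    exact ((by fun_prop : Continuous fun x : ℝ => Complex.exp (x * Complex.I)).tendsto θ).comp hlim
  -- The limit angle may be `2π`, which the half-open interval excludes; it is then replaced by `0`.
  obtain ⟨ψ, hψ, hexp, hs⟩ : ∃ ψ ∈ Set.Ico 0 (2 * Real.pi),
      Complex.exp (ψ * Complex.I) = Complex.exp (θ * Complex.I) ∧
      supportValue A c ψ = supportValue A c θ := by
    rcases hθ.2.lt_or_eq with h | rfl
    · exact ⟨θ, ⟨hθ.1, h⟩, rfl, rfl⟩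
    · refine ⟨0, ⟨le_rfl, Real.two_pi_pos⟩, by simp, ?_⟩
      exact (supportValue_congr c (hermPart_two_pi A)).symm
  refine ⟨ψ, hψ, le_antisymm (Set.mem_iInter₂.1 hvW ψ hψ) ?_⟩
  rw [hexp, hs]
  exact hge

end WeightedRange

/-! ### The resultant in `t` and its specialisations. -/

namespace WeightedRange

open Matrix Polynomial

/-- `ℂ[x, y, t] ≃ ℂ[x, y][t]`. -/
noncomputable def tPolyEquiv :
    MvPolynomial (Fin 3) ℂ ≃ₐ[ℂ] Polynomial (MvPolynomial (Fin 2) ℂ) :=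
  -- `finSuccEquiv` singles out variable `0`; the rotation sends `t = X 2` there and `x, y` to `X 1,
  -- X 2`.
  (MvPolynomial.renameEquiv ℂ (finRotate 3)).trans (MvPolynomial.finSuccEquiv ℂ 2)

theorem eval_map_tPolyEquiv (r : MvPolynomial (Fin 3) ℂ) (x y t : ℂ) :
    ((tPolyEquiv r).map (MvPolynomial.eval ![x, y])).eval t =
      MvPolynomial.eval ![x, y, t] r := by
  rw [tPolyEquiv, AlgEquiv.trans_apply, ← MvPolynomial.eval_eq_eval_mv_eval',
    MvPolynomial.renameEquiv_apply, MvPolynomial.eval_rename]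
  congr 2
  ext i
  fin_cases i <;> rfl

theorem map_tPolyEquiv_rPoly {n : ℕ} (A : Matrix (Fin n) (Fin n) ℂ) (c : Fin n → ℝ) (x y : ℂ) :
    (tPolyEquiv (rPoly A c)).map (MvPolynomial.eval ![x, y]) = cPoly (x • A + y • Aᴴ) c := by
  apply Polynomial.funext
  intro t
  rw [eval_map_tPolyEquiv, eval_rPoly]

theorem coeff_tPolyEquiv_rPoly {n : ℕ} (A : Matrix (Fin n) (Fin n) ℂ) (c : Fin n → ℝ)
    (v : Fin 2 → ℂ) (k : ℕ) : MvPolynomial.eval v ((tPolyEquiv (rPoly A c)).coeff k) =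
      (cPoly (v 0 • A + v 1 • Aᴴ) c).coeff k := by
  rw [← map_tPolyEquiv_rPoly, Polynomial.coeff_map]
  congr 2
  ext i
  fin_cases i <;> rfl

theorem natDegree_tPolyEquiv_rPoly_le {n : ℕ} (A : Matrix (Fin n) (Fin n) ℂ) (c : Fin n → ℝ) :
    (tPolyEquiv (rPoly A c)).natDegree ≤ (rearrangements c).card := by
  rw [Polynomial.natDegree_le_iff_coeff_eq_zero]
  intro k hk
  apply MvPolynomial.funext
  intro v
  rw [coeff_tPolyEquiv_rPoly, map_zero]
  exact Polynomial.coeff_eq_zero_of_natDegree_lt (by rwa [cPoly_natDegree])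

theorem coeff_card_tPolyEquiv_rPoly {n : ℕ} (A : Matrix (Fin n) (Fin n) ℂ) (c : Fin n → ℝ) :
    (tPolyEquiv (rPoly A c)).coeff (rearrangements c).card = 1 := by
  apply MvPolynomial.funext
  intro v
  rw [coeff_tPolyEquiv_rPoly, map_one, ← cPoly_natDegree (v 0 • A + v 1 • Aᴴ) c]
  exact cPoly_monic _ _

/-- Monicity keeps the degree in `t` fixed under specialisation of `x, y`, so resultants commute
with evaluation. -/
theorem tPolyEquiv_rPoly_monic {n : ℕ} (A : Matrix (Fin n) (Fin n) ℂ) (c : Fin n → ℝ) :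
    (tPolyEquiv (rPoly A c)).Monic :=
  Polynomial.monic_of_natDegree_le_of_coeff_eq_one _ (natDegree_tPolyEquiv_rPoly_le A c)
    (coeff_card_tPolyEquiv_rPoly A c)

theorem eval_resultant {F G : Polynomial (MvPolynomial (Fin 2) ℂ)} (hF : F.Monic) (hG : G.Monic)
    (v : Fin 2 → ℂ) : MvPolynomial.eval v (resultant F G) =
      resultant (F.map (MvPolynomial.eval v)) (G.map (MvPolynomial.eval v)) := by
  rw [hF.natDegree_map, hG.natDegree_map, resultant_map_map]

theorem resultant_eq_zero_of_common_root {F G : Polynomial ℂ} (hF : F.Monic) {t : ℂ}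
    (h1 : F.IsRoot t) (h2 : G.IsRoot t) : resultant F G = 0 := by
  refine resultant_eq_zero_iff.2 ⟨Or.inl hF.ne_zero, fun ⟨a, b, hab⟩ => ?_⟩
  have := congrArg (eval t) hab
  simp [h1.eq_zero, h2.eq_zero] at this

theorem exists_common_root_of_resultant_eq_zero {F G : Polynomial ℂ} (h : resultant F G = 0) :
    ∃ t, F.IsRoot t ∧ G.IsRoot t := by
  obtain ⟨h0, h⟩ := resultant_eq_zero_iff.1 h
  by_contra! hno
  refine h ((isCoprime_iff_aeval_ne_zero_of_isAlgClosed ℂ ℂ F G).2 fun t => ?_)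
  simpa only [coe_aeval_eq_eval, or_iff_not_imp_left, not_not, IsRoot.def] using hno t

/-- Gauss's lemma: over the fraction field `F` stays irreducible and is not coprime to `G`, and
divisibility descends because both are monic. -/
theorem dvd_of_resultant_eq_zero {R : Type*} [CommRing R] [IsDomain R] [IsIntegrallyClosed R]
    {F G : Polynomial R} (hF : F.Monic) (hG : G.Monic) (hirr : Irreducible F)
    (h : resultant F G = 0) : F ∣ G := by
  let K := FractionRing R
  refine hG.dvd_of_fraction_map_dvd_fraction_map (K := K) hF ?_
  have hirrK := (hF.irreducible_iff_irreducible_map_fraction_map (K := K)).1 hirr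
  have hres : resultant (F.map (algebraMap R K)) (G.map (algebraMap R K)) = 0 := by
    rw [hF.natDegree_map, hG.natDegree_map, resultant_map_map, h, map_zero]
  by_contra hdvd
  exact (resultant_eq_zero_iff.1 hres).2 (hirrK.coprime_iff_not_dvd.2 hdvd)

/-- For fixed `s ≠ 0` the value is a polynomial in `z` with infinitely many roots, and `s * z ^ 2`
takes every value. The excluded line `s = 0` is absorbed by the factor `X 1`. -/
theorem eq_zero_of_infinite_circle {R : MvPolynomial (Fin 2) ℂ} {Z : Set ℂ} (hZ : Z.Infinite)
    (h : ∀ z ∈ Z, ∀ s : ℂ, s ≠ 0 → MvPolynomial.eval ![s * z ^ 2, s] R = 0) : R = 0 := by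
  have h1 : ∀ x s : ℂ, s ≠ 0 → MvPolynomial.eval ![x, s] R = 0 := by
    intro x s hs
    let P : Polynomial ℂ := MvPolynomial.eval₂ C ![C s * X ^ 2, C s] R
    have hP : ∀ z, P.eval z = MvPolynomial.eval ![s * z ^ 2, s] R := by
      intro z
      rw [← coe_evalRingHom, MvPolynomial.hom_eval₂, MvPolynomial.eval, MvPolynomial.coe_eval₂Hom]
      congr 1
      · ext; simp
      · ext i; fin_cases i <;> simp
    have hP0 : P = 0 := Polynomial.eq_zero_of_infinite_isRoot P
      (hZ.mono fun z hz => (hP z).trans (h z hz s hs))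
    obtain ⟨z, hz⟩ := IsAlgClosed.exists_pow_nat_eq (x / s) (n := 2) two_pos
    have := hP z
    rw [hP0, hz, mul_div_cancel₀ _ hs] at this
    simpa using this.symm
  have h2 : R * MvPolynomial.X 1 = 0 := by
    apply MvPolynomial.funext
    intro v
    have hv : v = ![v 0, v 1] := by ext i; fin_cases i <;> rfl
    by_cases h0 : v 1 = 0
    · simp [h0]
    · rw [hv, map_mul, h1 _ _ h0]
      simp
  exact (mul_eq_zero.1 h2).resolve_right (MvPolynomial.X_ne_zero 1)

theorem resultant_tPolyEquiv_rPoly_eq_zero {n m : ℕ} {A : Matrix (Fin n) (Fin n) ℂ}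
    {B : Matrix (Fin m) (Fin m) ℂ} {c : Fin n → ℝ} {d : Fin m → ℝ}
    (h : {θ ∈ Set.Ico 0 (2 * Real.pi) | supportValue A c θ = supportValue B d θ}.Infinite) :
    resultant (tPolyEquiv (rPoly A c)) (tPolyEquiv (rPoly B d)) = 0 := by
  have hinj : Set.InjOn (fun θ : ℝ => Complex.exp (θ * Complex.I))
      {θ ∈ Set.Ico 0 (2 * Real.pi) | supportValue A c θ = supportValue B d θ} := by
    intro a ha b hb hab
    refine Circle.exp_injOn_Ico (by simp) ha.1 hb.1 (Circle.ext ?_)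
    simpa only [Circle.coe_exp] using hab
  refine eq_zero_of_infinite_circle (h.image hinj) ?_
  rintro _ ⟨θ, ⟨-, hθ⟩, rfl⟩ s hs
  rw [eval_resultant (tPolyEquiv_rPoly_monic A c) (tPolyEquiv_rPoly_monic B d),
    map_tPolyEquiv_rPoly, map_tPolyEquiv_rPoly]
  have hz : Complex.exp (θ * Complex.I) ≠ 0 := Complex.exp_ne_zero _
  have hscale : ∀ {k : ℕ} (M : Matrix (Fin k) (Fin k) ℂ),
      (s * Complex.exp (θ * Complex.I) ^ 2) • M + s • Mᴴ =
        (2 * s * Complex.exp (θ * Complex.I)) • hermPart M θ := by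
    intro k M
    rw [hermPart, smul_smul, smul_add, smul_smul, smul_smul, Complex.exp_neg]
    congr 2 <;> field_simp
  have h2 : 2 * s * Complex.exp (θ * Complex.I) ≠ 0 := by simp [hs]
  dsimp only
  rw [hscale, hscale]
  refine resultant_eq_zero_of_common_root (cPoly_monic _ _)
    (cPoly_isRoot_smul h2 (cPoly_isRoot_supportValue A c θ)) ?_
  rw [hθ]
  exact cPoly_isRoot_smul h2 (cPoly_isRoot_supportValue B d θ)

theorem exists_common_cValue {n m : ℕ} {A : Matrix (Fin n) (Fin n) ℂ}
    {B : Matrix (Fin m) (Fin m) ℂ} {c : Fin n → ℝ} {d : Fin m → ℝ}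
    (h : {θ ∈ Set.Ico 0 (2 * Real.pi) | supportValue A c θ = supportValue B d θ}.Infinite) :
    ∃ z : ℂ, IsCValue A c z ∧ IsCValue B d z := by
  -- At `(1, 0)` the pencil `xA + yA*` is `A` itself.
  have h0 := congrArg (MvPolynomial.eval ![1, 0]) (resultant_tPolyEquiv_rPoly_eq_zero h)
  rw [eval_resultant (tPolyEquiv_rPoly_monic A c) (tPolyEquiv_rPoly_monic B d),
    map_tPolyEquiv_rPoly, map_tPolyEquiv_rPoly, map_zero] at h0
  obtain ⟨z, hz⟩ := exists_common_root_of_resultant_eq_zero h0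
  simp only [one_smul, zero_smul, add_zero, cPoly_isRoot_iff_isCValue] at hz
  exact ⟨z, hz⟩

theorem isCValue_of_irreducible {n m : ℕ} {A : Matrix (Fin n) (Fin n) ℂ}
    {B : Matrix (Fin m) (Fin m) ℂ} {c : Fin n → ℝ} {d : Fin m → ℝ}
    (h : {θ ∈ Set.Ico 0 (2 * Real.pi) | supportValue A c θ = supportValue B d θ}.Infinite)
    (hirr : Irreducible (rPoly A c)) {z : ℂ} (hz : IsCValue A c z) : IsCValue B d z := by
  have hdvd := dvd_of_resultant_eq_zero (tPolyEquiv_rPoly_monic A c) (tPolyEquiv_rPoly_monic B d)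
    ((MulEquiv.irreducible_iff tPolyEquiv).2 hirr) (resultant_tPolyEquiv_rPoly_eq_zero h)
  have h1 := Polynomial.map_dvd (MvPolynomial.eval ![1, 0]) hdvd
  simp only [map_tPolyEquiv_rPoly, one_smul, zero_smul, add_zero] at h1
  rw [← cPoly_isRoot_iff_isCValue] at hz ⊢
  exact hz.dvd h1

end WeightedRange

/-! ### From the common curve to infinitely many common support values. -/

namespace WeightedRange

open Filter Topology

theorem eq_or_eq_neg_of_re_mul_eq_zero {u w v : ℂ} (hv : v ≠ 0) (huw : ‖u‖ = ‖w‖)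
    (h1 : (u * v).re = 0) (h2 : (w * v).re = 0) : u = w ∨ u = -w := by
  have h : |(u * v).im| = |(w * v).im| := by
    rw [Complex.abs_im_eq_norm.2 h1, Complex.abs_im_eq_norm.2 h2, norm_mul, norm_mul, huw]
  rcases abs_eq_abs.1 h with h | h
  · exact Or.inl (mul_right_cancel₀ hv (Complex.ext (h1.trans h2.symm) h))
  · refine Or.inr (mul_right_cancel₀ hv (Complex.ext ?_ ?_))
    · simp only [neg_mul, Complex.neg_re, h1, h2, neg_zero]
    · simp only [neg_mul, Complex.neg_im, h]

theorem collinear_of_re_mul_eq {S : Set ℂ} {u : ℂ} {k : ℝ} (hu : u ≠ 0)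
    (h : ∀ z ∈ S, (u * z).re = k) : Collinear ℝ S := by
  rw [collinear_iff_exists_forall_eq_smul_vadd]
  refine ⟨u⁻¹ * k, u⁻¹ * Complex.I, fun z hz => ⟨(u * z).im, ?_⟩⟩
  have h1 : u * z = k + (u * z).im * Complex.I := by
    conv_lhs => rw [← Complex.re_add_im (u * z), h z hz]
  rw [vadd_eq_add, Complex.real_smul]
  apply mul_left_cancel₀ hu
  refine h1.trans ?_
  generalize (u * z).im = y
  field_simp
  ring

/-- At an interior parameter of a differentiable curve, the direction of a supporting line of
the curve is unique, unless the curve is contained in a line. -/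
theorem IsDifferentiableCurve.direction_unique {γ : ℝ → ℂ} {I : Set ℝ}
    (hγ : IsDifferentiableCurve γ I) (hline : ¬ Collinear ℝ (γ '' I)) {s : ℝ}
    (hs : s ∈ interior I) {u w : ℂ} (hu : ‖u‖ = 1) (hw : ‖w‖ = 1)
    (humax : ∀ r ∈ I, (u * γ r).re ≤ (u * γ s).re)
    (hwmax : ∀ r ∈ I, (w * γ r).re ≤ (w * γ s).re) : u = w := by
  have hI : I ∈ 𝓝 s := mem_interior_iff_mem_nhds.1 hs
  obtain ⟨v, hv, hderiv⟩ := hγ.regular s (interior_subset hs)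
  have key : ∀ x : ℂ, (∀ r ∈ I, (x * γ r).re ≤ (x * γ s).re) → (x * v).re = 0 := by
    intro x hx
    have hd : HasDerivAt (fun r => (x * γ r).re) (x * v).re s :=
      Complex.reCLM.hasFDerivAt.comp_hasDerivAt s ((hderiv.hasDerivAt hI).const_mul x)
    refine IsLocalMax.hasDerivAt_eq_zero ?_ hd
    filter_upwards [hI] with r hr using hx r hr
  refine (eq_or_eq_neg_of_re_mul_eq_zero hv (hu.trans hw.symm) (key u humax)
    -- If `w = -u`, then `Re(u * γ)` is both maximal and minimal at `s`, hence constant.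
    (key w hwmax)).resolve_right fun h => hline ?_
  have hu0 : u ≠ 0 := fun h => by simp [h] at hu
  refine collinear_of_re_mul_eq (k := (u * γ s).re) hu0 ?_
  rintro _ ⟨r, hr, rfl⟩
  refine le_antisymm (humax r hr) ?_
  have := hwmax r hr
  rw [← neg_eq_iff_eq_neg.2 h] at this
  simpa only [neg_mul, Complex.neg_re, neg_le_neg_iff] using this

theorem infinite_supportValue_eq {n m : ℕ} {A : Matrix (Fin n) (Fin n) ℂ}
    {B : Matrix (Fin m) (Fin m) ℂ} {c : Fin n → ℝ} {d : Fin m → ℝ} {γ : ℝ → ℂ} {I : Set ℝ}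
    (hγ : IsDifferentiableCurve γ I) (hline : ¬ Collinear ℝ (γ '' I))
    (hlies : γ '' I ⊆ frontier (weightedRange A c) ∩ frontier (weightedRange B d)) :
    {θ ∈ Set.Ico 0 (2 * Real.pi) | supportValue A c θ = supportValue B d θ}.Infinite := by
  have hmem : ∀ {k : ℕ} {M : Matrix (Fin k) (Fin k) ℂ} {e : Fin k → ℝ},
      γ '' I ⊆ frontier (weightedRange M e) → ∀ θ ∈ Set.Ico 0 (2 * Real.pi), ∀ r ∈ I,
        (Complex.exp (θ * Complex.I) * γ r).re ≤ supportValue M e θ := by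
    intro k M e h θ hθ r hr
    exact Set.mem_iInter₂.1
      ((isClosed_weightedRange M e).frontier_subset (h (Set.mem_image_of_mem γ hr))) θ hθ
  have hA := hlies.trans Set.inter_subset_left
  have hB := hlies.trans Set.inter_subset_right
  have huniq : ∀ s ∈ interior I, ∀ θ ∈ Set.Ico 0 (2 * Real.pi), ∀ φ ∈ Set.Ico 0 (2 * Real.pi),
      (∀ r ∈ I, (Complex.exp (θ * Complex.I) * γ r).re ≤
        (Complex.exp (θ * Complex.I) * γ s).re) →
      (∀ r ∈ I, (Complex.exp (φ * Complex.I) * γ r).re ≤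
        (Complex.exp (φ * Complex.I) * γ s).re) → θ = φ := by
    intro s hs θ hθ φ hφ h1 h2
    have := hγ.direction_unique hline hs (Complex.norm_exp_ofReal_mul_I θ)
      (Complex.norm_exp_ofReal_mul_I φ) h1 h2
    refine Circle.exp_injOn_Ico (by simp) hθ hφ (Circle.ext ?_)
    simpa only [Circle.coe_exp] using this
  set T := {θ ∈ Set.Ico 0 (2 * Real.pi) | supportValue A c θ = supportValue B d θ}
  let L : ℝ → Set ℂ := fun θ => {z | (Complex.exp (θ * Complex.I) * z).re = supportValue A c θ}
  have hLclosed : ∀ θ, IsClosed (L θ) := fun θ =>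
    isClosed_eq (by fun_prop) continuous_const
  have hcover : ∀ s ∈ interior I, ∃ θ ∈ T, γ s ∈ L θ := by
    intro s hs
    have hsI := Set.mem_image_of_mem γ (interior_subset hs)
    obtain ⟨θ, hθ, h1⟩ := exists_eq_supportValue_of_mem_frontier (hA hsI)
    obtain ⟨φ, hφ, h2⟩ := exists_eq_supportValue_of_mem_frontier (hB hsI)
    obtain rfl := huniq s hs θ hθ φ hφ (fun r hr => (hmem hA θ hθ r hr).trans h1.ge)
      (fun r hr => (hmem hB φ hφ r hr).trans h2.ge)
    exact ⟨θ, ⟨hθ, h1.symm.trans h2⟩, h1⟩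
  have hdisj : ∀ s ∈ interior I, ∀ θ ∈ T, ∀ φ ∈ T, γ s ∈ L θ → γ s ∈ L φ → θ = φ := by
    intro s hs θ hθ φ hφ h1 h2
    exact huniq s hs θ hθ.1 φ hφ.1 (fun r hr => (hmem hA θ hθ.1 r hr).trans (Eq.ge h1))
      (fun r hr => (hmem hA φ hφ.1 r hr).trans (Eq.ge h2))
  have hcont : ContinuousOn γ I := fun s hs =>
    let ⟨_, _, h⟩ := hγ.regular s hs
    h.continuousWithinAt
  have hconv : Convex ℝ I := hγ.interval.convex
  obtain ⟨a, ha, b, hb, hab⟩ : ∃ a ∈ I, ∃ b ∈ I, a < b := by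
    by_contra! h
    have hsub : I.Subsingleton := fun x hx y hy => le_antisymm (h y hy x hx) (h x hx y hy)
    rcases (hsub.image γ).eq_empty_or_singleton with h | ⟨z, h⟩
    · exact hline (h ▸ collinear_empty ℝ ℂ)
    · exact hline (h ▸ collinear_singleton ℝ z)
  have hne : (interior I).Nonempty := by
    have : Set.Ioo a b ⊆ interior I :=
      interior_maximal (Set.Ioo_subset_Icc_self.trans (hγ.interval.out ha hb)) isOpen_Ioo
    exact (Set.nonempty_Ioo.2 hab).mono this
  have hpre : IsPreconnected (γ '' interior I) :=
    hconv.interior.isPreconnected.image γ (hcont.mono interior_subset)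
  intro hfin
  obtain ⟨s₀, hs₀⟩ := hne
  obtain ⟨θ₀, hθ₀, hL₀⟩ := hcover s₀ hs₀
  have hsub : γ '' interior I ⊆ L θ₀ := by
    rintro _ ⟨s, hs, rfl⟩
    by_contra hnot
    obtain ⟨θ, hθ, hL⟩ := hcover s hs
    have hθne : θ ≠ θ₀ := by
      rintro rfl
      exact hnot hL
    -- By `hdisj`, `L θ₀` and the finite union of the other lines are closed sets that do not meet
    -- on the connected curve, yet cover it.
    have hclosed : IsClosed (⋃ φ ∈ T \ {θ₀}, L φ) :=
      (hfin.subset Set.sdiff_subset).isClosed_biUnion fun φ _ => hLclosed φ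
    obtain ⟨_, ⟨r, hr, rfl⟩, h1, h2⟩ := isPreconnected_closed_iff.1 hpre _ _ (hLclosed θ₀) hclosed
      (by
        rintro _ ⟨r, hr, rfl⟩
        obtain ⟨φ, hφ, hφL⟩ := hcover r hr
        by_cases h : φ = θ₀
        · exact Or.inl (h ▸ hφL)
        · exact Or.inr (Set.mem_biUnion ⟨hφ, h⟩ hφL))
      ⟨_, ⟨s₀, hs₀, rfl⟩, hL₀⟩ ⟨_, ⟨s, hs, rfl⟩, Set.mem_biUnion ⟨hθ, hθne⟩ hL⟩
    obtain ⟨φ, hφ, hφL⟩ := Set.mem_iUnion₂.1 h2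
    exact hφ.2 (hdisj r hr φ hφ.1 θ₀ hθ₀ hφL h1)
  refine hline (collinear_of_re_mul_eq (k := supportValue A c θ₀)
    (Complex.exp_ne_zero (θ₀ * Complex.I)) fun z hz => ?_)
  obtain ⟨r, hr, rfl⟩ := hz
  -- Tangency was used only at interior parameters; continuity extends the conclusion to the
  -- endpoints of `I`.
  have hrcl : r ∈ closure (interior I) := by
    rw [hconv.closure_interior_eq_closure_of_nonempty_interior ⟨s₀, hs₀⟩]
    exact subset_closure hr
  have := ((hcont r hr).mono interior_subset).mem_closure_image hrcl
  exact (hLclosed θ₀).closure_subset_iff.2 hsub this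

end WeightedRange

theorem mainTheorem6 {n m : ℕ} (A : Matrix (Fin n) (Fin n) ℂ) (B : Matrix (Fin m) (Fin m) ℂ)
    (c : Fin n → ℝ) (d : Fin m → ℝ) (γ : ℝ → ℂ) (I : Set ℝ)
    (hγ : WeightedRange.IsDifferentiableCurve γ I)
    (hline : ¬ Collinear ℝ (γ '' I))
    (hlies : γ '' I ⊆ frontier (WeightedRange.weightedRange A c) ∩
      frontier (WeightedRange.weightedRange B d)) :
    (∃ z : ℂ, WeightedRange.IsCValue A c z ∧ WeightedRange.IsCValue B d z) ∧
    (Irreducible (WeightedRange.rPoly A c) →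
      ∀ z : ℂ, WeightedRange.IsCValue A c z → WeightedRange.IsCValue B d z) := by
  have h := WeightedRange.infinite_supportValue_eq hγ hline hlies
  exact ⟨WeightedRange.exists_common_cValue h,
    fun hirr _ hz => WeightedRange.isCValue_of_irreducible h hirr hz⟩
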